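/- For every real number $A$ there is a constant $c_2>0$, depending only on $A$, such that the following holds. Let $X_0,X_1,X_2,\dots$ be independent real random variables on a probability space with $\mathbb{E}X_j=0$ for all $j$, and suppose that either 1. for all $j$, $|X_j|\le A$ almost surely; or 2. for all $j$, $X_j$ satisfies a logarithmic Sobolev inequality with constant $A$, that is, $$\mathbb{E}\big[f^2(X_j)\log f^2(X_j)\big]\le 2A\,\mathbb{E}\big[f'(X_j)^2\big]$$ for every smooth $f:\mathbb{R}\to\mathbb{R}$ such that $\mathbb{E}f^2(X_j)=1$ and $\mathbb{E}[f'(X_j)^2]<\infty$ (with $0\log 0=0$). For $n\ge 2$ let $T_n=\big[X_{|j-k|}\big]_{1\le j,k\le n}$ be the $n\times n$ random symmetric Toeplitz matrix, and let $\|T_n\|$ be its spectral norm, i.e. its operator norm on $\mathbb{R}^n$ with the Euclidean norm (equivalently, the maximum absolute value of an eigenvalue of $T_n$). Then, almost surely, $$\limsup_{n\to\infty}\frac{\|T_n\|}{\sqrt{n\log n}}\le c_2 .$$ -/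

import Mathlib

open MeasureTheory ProbabilityTheory Filter

noncomputable section

open scoped ContDiff

/-- The `n × n` symmetric Toeplitz matrix `[x_{|j-k|}]`. -/
def symToeplitz (x : ℕ → ℝ) (n : ℕ) : Matrix (Fin n) (Fin n) ℝ :=
  Matrix.of fun j k => x ((j : ℤ) - (k : ℤ)).natAbs

/-- The spectral norm of a square real matrix: its operator norm on Euclidean space. -/
def spectralNorm₂ {n : ℕ} (M : Matrix (Fin n) (Fin n) ℝ) : ℝ :=
  ‖Matrix.toEuclideanCLM (n := Fin n) (𝕜 := ℝ) M‖

/-- The probability measure `μ` on `ℝ` satisfies a logarithmic Sobolev inequality with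
constant `A`: for every smooth `f` with `∫ f² dμ = 1`,
`∫ f² log f² dμ ≤ 2 A ∫ (f')² dμ`.
Here `0 log 0 = 0`. The condition is void when the right-hand integral is infinite. Since
`f² log f²` is bounded below, the left-hand integral always exists in `(-∞, ∞]`; that it is
finite when the right-hand side is finite is part of the inequality. -/
def SatisfiesLSI (μ : Measure ℝ) (A : ℝ) : Prop :=
  ∀ f : ℝ → ℝ, ContDiff ℝ ∞ f → ∫ x, f x ^ 2 ∂μ = 1 →
    Integrable (fun x => deriv f x ^ 2) μ →
      Integrable (fun x => f x ^ 2 * Real.log (f x ^ 2)) μ ∧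
        ∫ x, f x ^ 2 * Real.log (f x ^ 2) ∂μ ≤ 2 * A * ∫ x, deriv f x ^ 2 ∂μ

end

/-! `T_n` is a corner of a symmetric circulant of order `2n`, whose eigenvalues are the values of
the symbol at `πk/n`, `k < 2n`. By Parseval, `‖T_n‖` is at most the largest of these in absolute
value (`spectralNorm₂_symToeplitz_le`): a maximum over finitely many points, so no net or chaining
is needed.

Each value is a sum of `n` independent terms with weights at most `2`, hence sub-Gaussian with proxy
`4nc` once the entries have proxy `c`. At level `√(24 c n log n)` its tail is `2n⁻³`; a union bound
over `2n` points leaves `4n⁻²`, and Borel–Cantelli concludes.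

Entries are sub-Gaussian by Hoeffding's lemma in the bounded case and by Herbst's argument
(`SatisfiesLSI.hasSubgaussianMGF`) under the log-Sobolev inequality. -/

/-! ### Herbst's argument: from log-Sobolev to sub-Gaussian. -/

/-- If `t K'(t) - K(t) ≤ a t² / 2` for `t > 0` and `K(0) = 0`, then `K(t) ≤ t K'(0) + a t² / 2`. -/
theorem le_of_mul_deriv_sub_le {K : ℝ → ℝ} {a : ℝ} (hK : Differentiable ℝ K) (h0 : K 0 = 0)
    (h : ∀ t, 0 < t → t * deriv K t - K t ≤ a * t ^ 2 / 2) {t : ℝ} (ht : 0 < t) :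
    K t ≤ t * deriv K 0 + a * t ^ 2 / 2 := by
  -- The hypothesis says that `K(s)/s - as/2` has nonpositive derivative; its limit at `0+` is
  -- `K'(0)`.
  have hd : ∀ s : ℝ, 0 < s → HasDerivAt (fun s => K s / s - a * s / 2)
      ((deriv K s * s - K s * 1) / s ^ 2 - a / 2) s := by
    intro s hs
    have h1 := (hK s).hasDerivAt.div (hasDerivAt_id s) hs.ne'
    have h2 := ((hasDerivAt_id s).const_mul a).div_const 2
    convert! h1.sub h2 using 1
    simp
  have hanti : AntitoneOn (fun s => K s / s - a * s / 2) (Set.Ioi 0) := by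
    refine antitoneOn_of_deriv_nonpos (convex_Ioi 0)
      (fun s hs => (hd s hs).continuousAt.continuousWithinAt)
      (fun s hs => ((hd s (interior_subset hs)).differentiableAt).differentiableWithinAt) ?_
    intro s hs
    have hs' : 0 < s := interior_subset hs
    rw [(hd s hs').deriv, sub_nonpos, div_le_iff₀ (by positivity)]
    linarith [h s hs']
  have hlim : Tendsto (fun s => K s / s - a * s / 2) (nhdsWithin 0 (Set.Ioi 0))
      (nhds (deriv K 0 - a * 0 / 2)) := by
    refine Tendsto.sub ?_ ?_
    · have := (hK 0).hasDerivAt.tendsto_slope.mono_left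
        (nhdsWithin_mono 0 (fun x (hx : 0 < x) => hx.ne'))
      refine this.congr fun s => ?_
      simp [slope_def_field, h0]
    · exact ((by fun_prop : Continuous fun s : ℝ => a * s / 2).tendsto 0).mono_left
        nhdsWithin_le_nhds
  have hle : K t / t - a * t / 2 ≤ deriv K 0 - a * 0 / 2 := by
    refine ge_of_tendsto hlim ?_
    filter_upwards [Ioo_mem_nhdsGT ht] with s hs
    exact hanti hs.1 ht hs.2.le
  have : K t / t ≤ deriv K 0 + a * t / 2 := by linarith
  rw [div_le_iff₀ ht] at this
  linarith

theorem integrable_exp_mul_of_bounded {μ : Measure ℝ} [IsFiniteMeasure μ] {N : ℝ} {φ : ℝ → ℝ}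
    (hφ : Continuous φ)
    (hN : ∀ x, |φ x| ≤ N) (t : ℝ) : Integrable (fun x => Real.exp (t * φ x)) μ :=
  integrable_exp_mul_of_mem_Icc hφ.measurable.aemeasurable
    (ae_of_all _ fun x => abs_le.1 (hN x))

namespace SatisfiesLSI

open scoped ContDiff

variable {μ : Measure ℝ} [IsProbabilityMeasure μ] {A a N : ℝ} {φ : ℝ → ℝ}

/-- The differential inequality in Herbst's argument. -/
theorem mul_deriv_cgf_sub_cgf_le (h : SatisfiesLSI μ A) (hAa : A ≤ a) (ha : 0 ≤ a)
    (hφ : ContDiff ℝ ∞ φ) (hN : ∀ x, |φ x| ≤ N) (hφ' : ∀ x, |deriv φ x| ≤ 1) (t : ℝ) :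
    t * deriv (cgf φ μ) t - cgf φ μ t ≤ a * t ^ 2 / 2 := by
  have hint := integrable_exp_mul_of_bounded (μ := μ) hφ.continuous hN
  have huniv : integrableExpSet φ μ = Set.univ := by
    ext s; simpa [integrableExpSet] using! hint s
  have hcgf := deriv_cgf (X := φ) (μ := μ) (v := t) (by simp [huniv])
  set K := cgf φ μ t with hK
  have hMpos : 0 < mgf φ μ t := mgf_pos (hint t)
  have hexpK : Real.exp K = mgf φ μ t := by rw [hK, cgf, Real.exp_log hMpos]
  -- `f²` is the density of the exponentially tilted law, so its entropy is `tK'(t) - K(t)`.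
  set f : ℝ → ℝ := fun x => Real.exp ((t * φ x - K) / 2) with hf
  have hfs : ∀ x, f x ^ 2 = Real.exp (t * φ x - K) := by
    intro x
    rw [hf, ← Real.exp_nat_mul]
    congr 1; push_cast; ring
  have hfs' : ∀ x, f x ^ 2 = Real.exp (t * φ x) / mgf φ μ t := by
    intro x; rw [hfs, Real.exp_sub, hexpK]
  have hfd : ContDiff ℝ ∞ f := by
    rw [hf]; fun_prop
  have hf1 : ∫ x, f x ^ 2 ∂μ = 1 := by
    simp_rw [hfs', integral_div]
    exact div_self hMpos.ne'
  have hfint : Integrable (fun x => f x ^ 2) μ := by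
    simp_rw [hfs']; exact (hint t).div_const _
  have hderiv : ∀ x, deriv f x = f x * (t * deriv φ x / 2) := by
    intro x
    have hd := (hφ.differentiable (by simp) x).hasDerivAt
    exact (((hd.const_mul t).sub_const K).div_const 2).exp.deriv
  have hbound : ∀ x, deriv f x ^ 2 ≤ t ^ 2 / 4 * f x ^ 2 := by
    intro x
    have h1 : deriv φ x ^ 2 ≤ 1 := (sq_le_one_iff_abs_le_one _).2 (hφ' x)
    rw [hderiv]
    calc _ = t ^ 2 / 4 * f x ^ 2 * deriv φ x ^ 2 := by ring
      _ ≤ t ^ 2 / 4 * f x ^ 2 * 1 := by gcongr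
      _ = _ := mul_one _
  have hdint : Integrable (fun x => deriv f x ^ 2) μ := by
    refine (hfint.const_mul (t ^ 2 / 4)).mono'
      ((measurable_deriv f).pow_const 2).aestronglyMeasurable (ae_of_all _ fun x => ?_)
    rw [Real.norm_of_nonneg (sq_nonneg _)]
    exact hbound x
  obtain ⟨-, hlsi⟩ := h f hfd hf1 hdint
  have hR : ∫ x, deriv f x ^ 2 ∂μ ≤ t ^ 2 / 4 := by
    calc _ ≤ ∫ x, t ^ 2 / 4 * f x ^ 2 ∂μ :=
          integral_mono hdint (hfint.const_mul _) hbound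
      _ = t ^ 2 / 4 := by rw [integral_const_mul, hf1, mul_one]
  have hR0 : 0 ≤ ∫ x, deriv f x ^ 2 ∂μ := integral_nonneg fun x => sq_nonneg _
  have hφint : Integrable (fun x => φ x * Real.exp (t * φ x)) μ := by
    simpa using integrable_pow_mul_exp_of_mem_interior_integrableExpSet (X := φ) (μ := μ)
      (v := t) (by simp [huniv]) 1
  have hL : ∫ x, f x ^ 2 * Real.log (f x ^ 2) ∂μ = t * deriv (cgf φ μ) t - K := by
    have : ∀ x, f x ^ 2 * Real.log (f x ^ 2)
        = t * (φ x * Real.exp (t * φ x) / mgf φ μ t) - K * f x ^ 2 := by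
      intro x
      have : Real.log (f x ^ 2) = t * φ x - K := by rw [hfs, Real.log_exp]
      rw [this, hfs']; ring
    simp_rw [this]
    rw [integral_sub ((hφint.div_const _).const_mul t) (hfint.const_mul K), integral_const_mul,
      integral_const_mul, hf1, integral_div, hcgf, mul_one]
  rw [hL] at hlsi
  calc _ ≤ 2 * A * ∫ x, deriv f x ^ 2 ∂μ := hlsi
    -- `A` may be negative; passing to `a ≥ 0` makes the next bound monotone.
    _ ≤ 2 * a * ∫ x, deriv f x ^ 2 ∂μ := by gcongr
    _ ≤ 2 * a * (t ^ 2 / 4) := by gcongr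
    _ = _ := by ring

theorem mgf_le_of_pos (h : SatisfiesLSI μ A) (hAa : A ≤ a) (ha : 0 ≤ a)
    (hφ : ContDiff ℝ ∞ φ) (hN : ∀ x, |φ x| ≤ N) (hφ' : ∀ x, |deriv φ x| ≤ 1) {t : ℝ}
    (ht : 0 < t) : mgf φ μ t ≤ Real.exp (t * ∫ x, φ x ∂μ + a * t ^ 2 / 2) := by
  have hint := integrable_exp_mul_of_bounded (μ := μ) hφ.continuous hN
  have huniv : integrableExpSet φ μ = Set.univ := by
    ext s; simpa [integrableExpSet] using! hint s
  have hK : Differentiable ℝ (cgf φ μ) := fun s =>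
    (analyticAt_cgf (by simp [huniv])).differentiableAt
  have := le_of_mul_deriv_sub_le hK cgf_zero
    (fun s _ => h.mul_deriv_cgf_sub_cgf_le hAa ha hφ hN hφ' s) ht
  rw [deriv_cgf_zero (by simp [huniv])] at this
  simp only [probReal_univ, div_one] at this
  rw [← Real.exp_log (mgf_pos (hint t))]
  exact Real.exp_le_exp.2 this

theorem mgf_le (h : SatisfiesLSI μ A) (hAa : A ≤ a) (ha : 0 ≤ a)
    (hφ : ContDiff ℝ ∞ φ) (hN : ∀ x, |φ x| ≤ N) (hφ' : ∀ x, |deriv φ x| ≤ 1) (t : ℝ) :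
    mgf φ μ t ≤ Real.exp (t * ∫ x, φ x ∂μ + a * t ^ 2 / 2) := by
  rcases lt_trichotomy t 0 with ht | rfl | ht
  · have := h.mgf_le_of_pos (φ := -φ) (N := N) hAa ha hφ.neg (by simpa using hN)
      (by simpa [deriv.neg] using hφ') (neg_pos.2 ht)
    simpa [mgf_neg, integral_neg] using this
  · simp
  · exact h.mgf_le_of_pos hAa ha hφ hN hφ' ht

/-- **Herbst's argument**: a centred law satisfying a logarithmic Sobolev inequality is
sub-Gaussian. -/
theorem hasSubgaussianMGF (h : SatisfiesLSI μ A) {c : NNReal} (hA : A ≤ c)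
    (hi : Integrable id μ) (h0 : ∫ x, x ∂μ = 0) : HasSubgaussianMGF id c μ := by
  -- A smooth, bounded, 1-Lipschitz truncation of the identity, dominated by `|x|`.
  set φ : ℕ → ℝ → ℝ := fun n x => ((n : ℝ) + 1) * Real.sin (x / ((n : ℝ) + 1)) with hφ
  have hpos : ∀ n : ℕ, (0 : ℝ) < n + 1 := fun n => by positivity
  have hcd : ∀ n, ContDiff ℝ ∞ (φ n) := fun n => by rw [hφ]; fun_prop
  have hb : ∀ n x, |φ n x| ≤ (n : ℝ) + 1 := fun n x => by
    rw [hφ, abs_mul, abs_of_pos (hpos n)]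
    exact mul_le_of_le_one_right (hpos n).le (Real.abs_sin_le_one _)
  have hbx : ∀ n x, |φ n x| ≤ |x| := fun n x => by
    have := Real.abs_sin_le_abs (x := x / ((n : ℝ) + 1))
    rw [hφ, abs_mul, abs_of_pos (hpos n)]
    calc _ ≤ ((n : ℝ) + 1) * |x / ((n : ℝ) + 1)| := by gcongr
      _ = |x| := by
        rw [abs_div, abs_of_pos (hpos n)]; field_simp
  have hd : ∀ n x, |deriv (φ n) x| ≤ 1 := fun n x => by
    have : HasDerivAt (φ n) (Real.cos (x / ((n : ℝ) + 1))) x := by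
      have := (((hasDerivAt_id x).div_const ((n : ℝ) + 1)).sin).const_mul ((n : ℝ) + 1)
      convert! this using 1
      simp only [id]
      field_simp
    rw [this.deriv]
    exact Real.abs_cos_le_one _
  have hlim : ∀ x, Tendsto (fun n => φ n x) atTop (nhds x) := fun x => by
    have h1 : Tendsto (fun n : ℕ => Real.sinc (x / ((n : ℝ) + 1)) * x) atTop
        (nhds (Real.sinc 0 * x)) := by
      refine Tendsto.mul_const x ((Real.continuous_sinc.tendsto 0).comp ?_)
      have := (tendsto_one_div_add_atTop_nhds_zero_nat (𝕜 := ℝ)).const_mul x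
      simpa [div_eq_mul_inv] using this
    rw [Real.sinc_zero, one_mul] at h1
    refine h1.congr fun n => ?_
    have := hpos n
    rcases eq_or_ne x 0 with rfl | hx
    · simp [hφ]
    · rw [Real.sinc_of_ne_zero (by positivity), hφ]
      field_simp
  have hmean : Tendsto (fun n => ∫ x, φ n x ∂μ) atTop (nhds 0) := by
    rw [← h0]
    refine tendsto_integral_of_dominated_convergence (fun x => |x|)
      (fun n => (hcd n).continuous.aestronglyMeasurable) hi.abs ?_ (ae_of_all _ hlim)
    exact fun n => ae_of_all _ (hbx n)
  -- Fatou for `lintegral`, since integrability of `exp (t x)` is not yet known.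
  have key : ∀ t : ℝ, ∫⁻ x, ENNReal.ofReal (Real.exp (t * x)) ∂μ
      ≤ ENNReal.ofReal (Real.exp (c * t ^ 2 / 2)) := by
    intro t
    have hle : ∀ n, ∫⁻ x, ENNReal.ofReal (Real.exp (t * φ n x)) ∂μ
        ≤ ENNReal.ofReal (Real.exp (t * ∫ x, φ n x ∂μ + c * t ^ 2 / 2)) := by
      intro n
      rw [← ofReal_integral_eq_lintegral_ofReal
        (integrable_exp_mul_of_bounded (hcd n).continuous (hb n) t)
        (ae_of_all _ fun x => (Real.exp_pos _).le)]
      exact ENNReal.ofReal_le_ofReal (h.mgf_le hA c.2 (hcd n) (hb n) (hd n) t)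
    have hRlim : Tendsto (fun n => ENNReal.ofReal
        (Real.exp (t * ∫ x, φ n x ∂μ + c * t ^ 2 / 2))) atTop
        (nhds (ENNReal.ofReal (Real.exp (c * t ^ 2 / 2)))) := by
      have := ((hmean.const_mul t).add_const ((c : ℝ) * t ^ 2 / 2))
      rw [mul_zero, zero_add] at this
      exact ENNReal.tendsto_ofReal ((Real.continuous_exp.tendsto _).comp this)
    calc ∫⁻ x, ENNReal.ofReal (Real.exp (t * x)) ∂μ
        = ∫⁻ x, liminf (fun n => ENNReal.ofReal (Real.exp (t * φ n x))) atTop ∂μ := by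
          refine lintegral_congr fun x => (Tendsto.liminf_eq ?_).symm
          exact ENNReal.tendsto_ofReal
            ((Real.continuous_exp.tendsto _).comp ((hlim x).const_mul t))
      _ ≤ liminf (fun n => ∫⁻ x, ENNReal.ofReal (Real.exp (t * φ n x)) ∂μ) atTop := by
          refine lintegral_liminf_le fun n => ?_
          have := (hcd n).continuous.measurable
          fun_prop
      _ ≤ liminf (fun n => ENNReal.ofReal
            (Real.exp (t * ∫ x, φ n x ∂μ + c * t ^ 2 / 2))) atTop :=
          liminf_le_liminf (Eventually.of_forall hle)
      _ = _ := hRlim.liminf_eq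
  have hmeas : ∀ t : ℝ, AEStronglyMeasurable (fun x : ℝ => Real.exp (t * x)) μ := fun t =>
    (by fun_prop : Continuous fun x : ℝ => Real.exp (t * x)).aestronglyMeasurable
  refine ⟨fun t => ⟨hmeas t, ?_⟩, fun t => ?_⟩
  · rw [hasFiniteIntegral_iff_ofReal (ae_of_all _ fun x => (Real.exp_pos _).le)]
    exact (key t).trans_lt ENNReal.ofReal_lt_top
  · change ∫ x, Real.exp (t * x) ∂μ ≤ _
    rw [integral_eq_lintegral_of_nonneg_ae (ae_of_all _ fun x => (Real.exp_pos _).le)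
      (hmeas t)]
    exact ENNReal.toReal_le_of_le_ofReal (Real.exp_pos _).le (key t)

end SatisfiesLSI

/-! ### Fourier analysis on the grid: norm bounded by symbol. -/

/-- The coefficients `1, 2, 2, …` of the cosine polynomial attached to a symmetric sequence. -/
def toeplitzCoeff (j : ℕ) : ℝ := if j = 0 then 1 else 2

/-- The symbol `x₀ + 2 ∑_{0 < j < n} x_j cos (j θ)` of the Toeplitz matrix, at `θ = π k / n`. -/
noncomputable def toeplitzSymbol (x : ℕ → ℝ) (n k : ℕ) : ℝ :=
  ∑ j ∈ Finset.range n, toeplitzCoeff j * Real.cos (j * (Real.pi * k / n)) * x j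

/-- For `0 < |m| < 2n`, `exp (iπm/n)` is a nontrivial `2n`-th root of unity, so its geometric sum
vanishes. -/
theorem sum_cos_int_mul {n : ℕ} (hn : 0 < n) {m : ℤ} (hm : m ≠ 0) (hmn : |m| < 2 * n) :
    ∑ k ∈ Finset.range (2 * n), Real.cos (m * (Real.pi * k / n)) = 0 := by
  have hnC : (n : ℂ) ≠ 0 := by exact_mod_cast hn.ne'
  set z : ℂ := Complex.exp (m * (Real.pi / n) * Complex.I) with hz
  have hzpow : ∀ k : ℕ, z ^ k = Complex.exp (((m * (Real.pi * k / n) : ℝ) : ℂ) * Complex.I) := by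
    intro k
    rw [hz, ← Complex.exp_nat_mul]
    congr 1
    push_cast
    ring
  have hz1 : z ≠ 1 := by
    rw [hz, Ne, Complex.exp_eq_one_iff]
    rintro ⟨l, hl⟩
    have h1 : (m : ℂ) = 2 * n * l := by
      have hpi : (Real.pi : ℂ) ≠ 0 := by exact_mod_cast Real.pi_ne_zero
      have : (m : ℂ) * (Real.pi * Complex.I) = 2 * n * l * (Real.pi * Complex.I) := by
        calc _ = n * (m * (Real.pi / n) * Complex.I) := by field_simp
          _ = _ := by rw [hl]; ring
      exact mul_right_cancel₀ (mul_ne_zero hpi Complex.I_ne_zero) this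
    have h2 : m = 2 * n * l := by exact_mod_cast h1
    exact hm (Int.eq_zero_of_abs_lt_dvd ⟨l, h2⟩ hmn)
  have hzN : z ^ (2 * n) = 1 := by
    rw [hz, ← Complex.exp_nat_mul, Complex.exp_eq_one_iff]
    refine ⟨m, ?_⟩
    push_cast
    field_simp
  have hgeom : ∑ k ∈ Finset.range (2 * n), z ^ k = 0 := by
    rw [geom_sum_eq hz1, hzN, sub_self, zero_div]
  have := congrArg Complex.re hgeom
  rw [Complex.re_sum] at this
  simpa only [hzpow, Complex.exp_ofReal_mul_I_re, Complex.zero_re] using this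

theorem sum_cos_int_mul_eq_ite {n : ℕ} (hn : 0 < n) {m : ℤ} (hmn : |m| < 2 * n) :
    ∑ k ∈ Finset.range (2 * n), Real.cos (m * (Real.pi * k / n)) =
      if m = 0 then 2 * (n : ℝ) else 0 := by
  split_ifs with h
  · simp [h]
  · exact sum_cos_int_mul hn h hmn

/-- Fourier inversion for the symbol on the grid `π k / n`, `k < 2 n`. -/
theorem sum_toeplitzSymbol_mul_cos (x : ℕ → ℝ) {n d : ℕ} (hd : d < n) :
    ∑ k ∈ Finset.range (2 * n), toeplitzSymbol x n k * Real.cos (d * (Real.pi * k / n)) =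
      2 * n * x d := by
  have hn : 0 < n := by omega
  simp_rw [toeplitzSymbol, Finset.sum_mul]
  rw [Finset.sum_comm, Finset.sum_eq_single_of_mem d (Finset.mem_range.2 hd)]
  all_goals
    have key : ∀ j < n, ∑ k ∈ Finset.range (2 * n), toeplitzCoeff j *
        Real.cos (j * (Real.pi * k / n)) * x j * Real.cos (d * (Real.pi * k / n)) =
        toeplitzCoeff j * x j / 2 * ((if (j : ℤ) + d = 0 then 2 * (n : ℝ) else 0) +
          if (j : ℤ) - d = 0 then 2 * (n : ℝ) else 0) := by
      intro j hj
      rw [← sum_cos_int_mul_eq_ite hn (by rw [abs_lt]; omega),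
        ← sum_cos_int_mul_eq_ite hn (by rw [abs_lt]; omega), ← Finset.sum_add_distrib,
        Finset.mul_sum]
      refine Finset.sum_congr rfl fun k _ => ?_
      push_cast
      rw [add_mul, sub_mul, Real.cos_add, Real.cos_sub]
      ring
  -- For `d = 0` both frequencies `j ± d` vanish, which compensates the coefficient `1` in place of
  -- `2`.
  · rw [key d hd, toeplitzCoeff]
    rcases eq_or_ne d 0 with rfl | h
    · simp; ring
    · rw [if_neg h, if_neg (by omega), if_pos (by omega)]; ring
  · intro j hj hjd
    rw [key j (Finset.mem_range.1 hj), if_neg (by omega), if_neg (by omega)]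
    simp

/-- The `k`-th cosine coefficient of a vector on the grid `π k / n`. -/
noncomputable def cosCoeff {n : ℕ} (x : Fin n → ℝ) (k : ℕ) : ℝ :=
  ∑ j : Fin n, x j * Real.cos (j * (Real.pi * k / n))

/-- The `k`-th sine coefficient of a vector on the grid `π k / n`. -/
noncomputable def sinCoeff {n : ℕ} (x : Fin n → ℝ) (k : ℕ) : ℝ :=
  ∑ j : Fin n, x j * Real.sin (j * (Real.pi * k / n))

/-- The left side is the real part of `û(k)` times the conjugate of `ŷ(k)`, with `û` the transform
of `x`; evenness of cosine allows `natAbs`. -/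
theorem cosCoeff_mul_add_sinCoeff_mul {n : ℕ} (x y : Fin n → ℝ) (k : ℕ) :
    cosCoeff x k * cosCoeff y k + sinCoeff x k * sinCoeff y k =
      ∑ i : Fin n, ∑ j : Fin n, x i * y j *
        Real.cos (((i : ℤ) - (j : ℤ)).natAbs * (Real.pi * k / n)) := by
  simp_rw [cosCoeff, sinCoeff, Finset.sum_mul_sum, ← Finset.sum_add_distrib]
  refine Finset.sum_congr rfl fun i _ => Finset.sum_congr rfl fun j _ => ?_
  have : Real.cos (((i : ℤ) - (j : ℤ)).natAbs * (Real.pi * k / n)) =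
      Real.cos (i * (Real.pi * k / n) - j * (Real.pi * k / n)) := by
    rw [← sub_mul, Nat.cast_natAbs]
    push_cast
    rcases abs_choice ((i : ℝ) - (j : ℝ)) with h | h <;> rw [h]
    rw [neg_mul, Real.cos_neg]
  rw [this, Real.cos_sub]
  ring

theorem natAbs_sub_lt {n : ℕ} (i j : Fin n) : ((i : ℤ) - (j : ℤ)).natAbs < n := by omega

/-- The Fourier diagonalisation of the circulant, tested on vectors supported on the first `n`
coordinates. -/
theorem sum_toeplitzSymbol_mul_coeff (x : ℕ → ℝ) {n : ℕ} (u v : Fin n → ℝ) :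
    ∑ k ∈ Finset.range (2 * n), toeplitzSymbol x n k *
      (cosCoeff u k * cosCoeff v k + sinCoeff u k * sinCoeff v k) =
      2 * n * ∑ i : Fin n, ∑ j : Fin n, u i * v j * symToeplitz x n i j := by
  simp_rw [cosCoeff_mul_add_sinCoeff_mul, Finset.mul_sum]
  rw [Finset.sum_comm]
  refine Finset.sum_congr rfl fun i _ => ?_
  rw [Finset.sum_comm]
  refine Finset.sum_congr rfl fun j _ => ?_
  rw [symToeplitz, Matrix.of_apply, mul_left_comm,
    ← sum_toeplitzSymbol_mul_cos x (natAbs_sub_lt i j), Finset.mul_sum]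
  exact Finset.sum_congr rfl fun k _ => by ring

/-- Parseval's identity on the grid. -/
theorem sum_cosCoeff_sq_add_sinCoeff_sq {n : ℕ} (u : Fin n → ℝ) :
    ∑ k ∈ Finset.range (2 * n), (cosCoeff u k ^ 2 + sinCoeff u k ^ 2) =
      2 * n * ∑ i : Fin n, u i ^ 2 := by
  simp_rw [sq, cosCoeff_mul_add_sinCoeff_mul, Finset.mul_sum]
  rw [Finset.sum_comm]
  refine Finset.sum_congr rfl fun i _ => ?_
  rw [Finset.sum_comm, Finset.sum_eq_single_of_mem i (Finset.mem_univ i)]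
  · simp
  · intro j _ hj
    have hji : ((i : ℤ) - (j : ℤ)).natAbs ≠ 0 := by
      have := Fin.val_ne_of_ne hj
      omega
    have hlt := natAbs_sub_lt i j
    have := sum_cos_int_mul (n := n) (by omega) (m := (((i : ℤ) - (j : ℤ)).natAbs : ℤ))
      (by exact_mod_cast hji) (by rw [abs_lt]; omega)
    rw [← Finset.mul_sum]
    simp only [Int.cast_natCast] at this
    rw [this, mul_zero]

/-- The spectral norm of a symmetric Toeplitz matrix is at most the maximum of its symbol on the
grid `π k / n`, `k < 2 n`. -/
theorem spectralNorm₂_symToeplitz_le (x : ℕ → ℝ) {n : ℕ} (hn : 0 < n) {M : ℝ} (hM : 0 ≤ M)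
    (h : ∀ k < 2 * n, |toeplitzSymbol x n k| ≤ M) :
    spectralNorm₂ (symToeplitz x n) ≤ M := by
  have hn' : (0 : ℝ) < n := by exact_mod_cast hn
  refine ContinuousLinearMap.opNorm_le_of_re_inner_le hM fun u v hu hv => ?_
  have hinner : inner ℝ (Matrix.toEuclideanCLM (n := Fin n) (𝕜 := ℝ) (symToeplitz x n) u) v =
      ∑ i : Fin n, ∑ j : Fin n, v i * u j * symToeplitz x n i j := by
    rw [PiLp.inner_apply]
    refine Finset.sum_congr rfl fun i _ => ?_
    rw [Matrix.ofLp_toEuclideanCLM]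
    simp only [Matrix.mulVec, dotProduct, RCLike.inner_apply, conj_trivial, Finset.mul_sum]
    exact Finset.sum_congr rfl fun j _ => by ring
  have hsq : ∀ w : EuclideanSpace ℝ (Fin n), ‖w‖ = 1 → ∑ i, w i ^ 2 = 1 := fun w hw => by
    rw [← EuclideanSpace.real_norm_sq_eq, hw, one_pow]
  have hpar : ∀ w : EuclideanSpace ℝ (Fin n), ‖w‖ = 1 →
      ∑ k ∈ Finset.range (2 * n), (cosCoeff w k ^ 2 + sinCoeff w k ^ 2) = 2 * n := fun w hw => by
    rw [sum_cosCoeff_sq_add_sinCoeff_sq, hsq w hw, mul_one]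
  have hterm : ∀ k ∈ Finset.range (2 * n), toeplitzSymbol x n k *
      (cosCoeff v k * cosCoeff u k + sinCoeff v k * sinCoeff u k) ≤
      M / 2 * ((cosCoeff v k ^ 2 + sinCoeff v k ^ 2) +
        (cosCoeff u k ^ 2 + sinCoeff u k ^ 2)) := by
    intro k hk
    have h1 : |cosCoeff v k * cosCoeff u k + sinCoeff v k * sinCoeff u k| ≤
        ((cosCoeff v k ^ 2 + sinCoeff v k ^ 2) + (cosCoeff u k ^ 2 + sinCoeff u k ^ 2)) / 2 := by
      rw [abs_le]
      constructor <;>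
      nlinarith [sq_nonneg (cosCoeff v k - cosCoeff u k), sq_nonneg (sinCoeff v k - sinCoeff u k),
        sq_nonneg (cosCoeff v k + cosCoeff u k), sq_nonneg (sinCoeff v k + sinCoeff u k)]
    calc _ ≤ |toeplitzSymbol x n k| *
          |cosCoeff v k * cosCoeff u k + sinCoeff v k * sinCoeff u k| := by
          rw [← abs_mul]; exact le_abs_self _
      _ ≤ M * (((cosCoeff v k ^ 2 + sinCoeff v k ^ 2) +
          (cosCoeff u k ^ 2 + sinCoeff u k ^ 2)) / 2) :=
          mul_le_mul (h k (Finset.mem_range.1 hk)) h1 (abs_nonneg _) hM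
      _ = _ := by ring
  have hsum := Finset.sum_le_sum hterm
  rw [sum_toeplitzSymbol_mul_coeff, ← Finset.mul_sum, Finset.sum_add_distrib, hpar v hv,
    hpar u hu, ← hinner] at hsum
  have : 2 * (n : ℝ) * inner ℝ (Matrix.toEuclideanCLM (n := Fin n) (𝕜 := ℝ)
      (symToeplitz x n) u) v ≤ 2 * n * M := by linarith
  exact le_of_mul_le_mul_left this (by positivity)

/-! ### Tail bounds and Borel–Cantelli. -/

section Tail

variable {Ω : Type*} [MeasurableSpace Ω] {P : Measure Ω}

theorem ProbabilityTheory.HasSubgaussianMGF.mono {Y : Ω → ℝ} {c d : NNReal}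
    (h : HasSubgaussianMGF Y c P) (hcd : c ≤ d) : HasSubgaussianMGF Y d P where
  integrable_exp_mul := h.integrable_exp_mul
  mgf_le t := (h.mgf_le t).trans <| Real.exp_le_exp.2 <| by
    have : (c : ℝ) ≤ d := hcd
    gcongr

theorem ProbabilityTheory.HasSubgaussianMGF.measure_abs_ge_le [IsFiniteMeasure P] {Y : Ω → ℝ}
    {c : NNReal} (h : HasSubgaussianMGF Y c P) {ε : ℝ} (hε : 0 ≤ ε) :
    P {ω | ε ≤ |Y ω|} ≤ ENNReal.ofReal (2 * Real.exp (-ε ^ 2 / (2 * c))) := by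
  have h1 := h.measure_ge_le hε
  have h2 := h.neg.measure_ge_le hε
  have hsub : {ω | ε ≤ |Y ω|} ⊆ {ω | ε ≤ Y ω} ∪ {ω | ε ≤ (-Y) ω} := by
    intro ω hω
    simpa [le_abs] using hω
  rw [← ofReal_measureReal]
  refine ENNReal.ofReal_le_ofReal ?_
  calc _ ≤ P.real ({ω | ε ≤ Y ω} ∪ {ω | ε ≤ (-Y) ω}) := measureReal_mono hsub
    _ ≤ P.real {ω | ε ≤ Y ω} + P.real {ω | ε ≤ (-Y) ω} := measureReal_union_le _ _
    _ ≤ _ := by linarith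

variable {X : ℕ → Ω → ℝ} {c : NNReal}

theorem hasSubgaussianMGF_toeplitzSymbol (hind : iIndepFun X P)
    (hX : ∀ j, HasSubgaussianMGF (X j) c P) (n k : ℕ) :
    HasSubgaussianMGF (fun ω => toeplitzSymbol (fun j => X j ω) n k) (4 * n * c) P := by
  set r : ℕ → ℝ := fun j => toeplitzCoeff j * Real.cos (j * (Real.pi * k / n)) with hr
  have hr4 : ∀ j, r j ^ 2 ≤ 4 := fun j => by
    have h1 : toeplitzCoeff j ^ 2 ≤ 4 := by rw [toeplitzCoeff]; split_ifs <;> norm_num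
    calc r j ^ 2 = toeplitzCoeff j ^ 2 * Real.cos (j * (Real.pi * k / n)) ^ 2 := by
          rw [hr, mul_pow]
      _ ≤ 4 * 1 := mul_le_mul h1 (Real.cos_sq_le_one _) (sq_nonneg _) (by norm_num)
      _ = 4 := by norm_num
  have hind' : iIndepFun (fun j ω => r j * X j ω) P :=
    hind.comp (fun j y => r j * y) fun j => measurable_const_mul _
  have hsub : ∀ j ∈ Finset.range n, HasSubgaussianMGF (fun ω => r j * X j ω) (4 * c) P :=
    fun j _ => ((hX j).const_mul (r j)).mono (mul_le_mul_of_nonneg_right (a := c)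
      (NNReal.coe_le_coe.1 (hr4 j)) zero_le)
  have := HasSubgaussianMGF.sum_of_iIndepFun hind' hsub
  refine (this.mono (le_of_eq ?_))
  rw [Finset.sum_const, Finset.card_range, nsmul_eq_mul]
  ring

/-- Almost surely `‖T_n‖ ≤ √(24 c) √(n log n)` for all large `n`, if the entries are sub-Gaussian
with variance proxy `c`. -/
theorem ae_eventually_spectralNorm₂_le [IsProbabilityMeasure P] (hind : iIndepFun X P)
    (hc : 0 < c) (hX : ∀ j, HasSubgaussianMGF (X j) c P) :
    ∀ᵐ ω ∂P, ∀ᶠ n : ℕ in atTop, spectralNorm₂ (symToeplitz (fun j => X j ω) n) ≤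
      Real.sqrt (24 * c) * Real.sqrt ((n : ℝ) * Real.log n) := by
  set ε : ℕ → ℝ := fun n => Real.sqrt (24 * c) * Real.sqrt ((n : ℝ) * Real.log n) with hε
  have hε0 : ∀ n, 0 ≤ ε n := fun n => by positivity
  set B : ℕ → Set Ω := fun n => ⋃ k ∈ Finset.range (2 * n),
    {ω | ε n ≤ |toeplitzSymbol (fun j => X j ω) n k|} with hB
  have hc' : (0 : ℝ) < c := hc
  have hPB : ∀ n, P (B n) ≤ ENNReal.ofReal (4 * (1 / (n : ℝ) ^ 2)) := by
    intro n
    rcases Nat.eq_zero_or_pos n with rfl | hn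
    · simp [hB]
    have hn' : (0 : ℝ) < n := by exact_mod_cast hn
    have hlog : 0 ≤ Real.log n := Real.log_natCast_nonneg n
    -- The constant `24` makes the exponent `24 c n log n / (8 n c) = 3 log n`.
    have hexp : Real.exp (-ε n ^ 2 / (2 * ((4 * n * c : NNReal) : ℝ))) = 1 / (n : ℝ) ^ 3 := by
      have : -ε n ^ 2 / (2 * ((4 * n * c : NNReal) : ℝ)) = -(3 * Real.log n) := by
        rw [hε, mul_pow, Real.sq_sqrt (by positivity), Real.sq_sqrt (by positivity)]
        push_cast
        field_simp
        ring
      rw [this, Real.exp_neg, one_div]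
      congr 1
      rw [← Real.log_rpow hn', Real.exp_log (by positivity)]
      exact_mod_cast rfl
    calc P (B n) ≤ ∑ k ∈ Finset.range (2 * n),
          P {ω | ε n ≤ |toeplitzSymbol (fun j => X j ω) n k|} := measure_biUnion_finset_le _ _
      _ ≤ ∑ k ∈ Finset.range (2 * n), ENNReal.ofReal (2 * (1 / (n : ℝ) ^ 3)) := by
          refine Finset.sum_le_sum fun k _ => ?_
          rw [← hexp]
          exact (hasSubgaussianMGF_toeplitzSymbol hind hX n k).measure_abs_ge_le (hε0 n)
      _ = ENNReal.ofReal (4 * (1 / (n : ℝ) ^ 2)) := by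
          rw [← ENNReal.ofReal_sum_of_nonneg (fun _ _ => by positivity)]
          congr 1
          rw [Finset.sum_const, Finset.card_range, nsmul_eq_mul]
          push_cast
          field_simp
          norm_num
  have hsum : ∑' n, P (B n) ≠ ⊤ := by
    have hs : Summable fun n : ℕ => 4 * (1 / (n : ℝ) ^ 2) :=
      (Real.summable_one_div_nat_pow.2 one_lt_two).mul_left 4
    refine ne_top_of_le_ne_top ?_ (ENNReal.tsum_le_tsum hPB)
    exact hs.tsum_ofReal_ne_top
  filter_upwards [ae_eventually_notMem hsum] with ω hω
  filter_upwards [hω, eventually_gt_atTop 0] with n hn hn0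
  refine spectralNorm₂_symToeplitz_le _ hn0 (hε0 n) fun k hk => ?_
  by_contra! hlt
  exact hn (Set.mem_biUnion (Finset.mem_coe.2 (Finset.mem_range.2 hk)) hlt.le)

end Tail

/-! ### The two hypotheses combined. -/

theorem theorem2 (A : ℝ) :
    ∃ c₂ : ℝ, 0 < c₂ ∧
      ∀ (Ω : Type*) [MeasurableSpace Ω] (P : Measure Ω) [IsProbabilityMeasure P]
        (X : ℕ → Ω → ℝ),
        (∀ j, Measurable (X j)) →
        iIndepFun X P →
        (∀ j, Integrable (X j) P ∧ ∫ ω, X j ω ∂P = 0) →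
        ((∀ j, ∀ᵐ ω ∂P, |X j ω| ≤ A) ∨ (∀ j, SatisfiesLSI (P.map (X j)) A)) →
        ∀ᵐ ω ∂P,
          limsup (fun n : ℕ =>
            ((spectralNorm₂ (symToeplitz (fun j => X j ω) n) /
              Real.sqrt ((n : ℝ) * Real.log (n : ℝ)) : ℝ) : EReal)) atTop ≤ (c₂ : EReal) := by
  -- Dominates both the Hoeffding proxy `A²` and the log-Sobolev proxy `A`; the `+ 1` keeps it
  -- positive.
  set c : NNReal := ⟨A ^ 2 + |A| + 1, by positivity⟩
  have hc : 0 < c := show (0 : ℝ) < A ^ 2 + |A| + 1 by positivity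
  have hc' : (0 : ℝ) < c := hc
  refine ⟨Real.sqrt (24 * c), by positivity, ?_⟩
  intro Ω _ P _ X hmeas hind hmean hX
  have hsub : ∀ j, HasSubgaussianMGF (X j) c P := by
    intro j
    rcases hX with hX | hX
    · refine (hasSubgaussianMGF_of_mem_Icc_of_integral_eq_zero (a := -A) (b := A)
        (hmeas j).aemeasurable ?_ (hmean j).2).mono ?_
      · filter_upwards [hX j] with ω hω using abs_le.1 hω
      · rw [← NNReal.coe_le_coe]
        have : ‖A - -A‖ / 2 = |A| := by
          rw [sub_neg_eq_add, ← two_mul, norm_mul, Real.norm_eq_abs, Real.norm_eq_abs]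
          norm_num
        simp only [NNReal.coe_pow, NNReal.coe_div, coe_nnnorm, NNReal.coe_ofNat, this, sq_abs]
        change A ^ 2 ≤ A ^ 2 + |A| + 1
        linarith [abs_nonneg A]
    · have := Measure.isProbabilityMeasure_map (μ := P) (hmeas j).aemeasurable
      rw [← HasSubgaussianMGF.id_map_iff (hmeas j).aemeasurable]
      refine (hX j).hasSubgaussianMGF ?_ ?_ ?_
      · change A ≤ A ^ 2 + |A| + 1
        linarith [le_abs_self A, sq_nonneg A]
      · rw [integrable_map_measure aestronglyMeasurable_id (hmeas j).aemeasurable]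
        exact (hmean j).1
      · rw [integral_map (f := fun x => x) (hmeas j).aemeasurable aestronglyMeasurable_id]
        exact (hmean j).2
  filter_upwards [ae_eventually_spectralNorm₂_le hind hc hsub] with ω hω
  refine limsup_le_of_le (by isBoundedDefault) ?_
  filter_upwards [hω, eventually_gt_atTop 1] with n hn hn1
  have hn1' : (1 : ℝ) < n := by exact_mod_cast hn1
  have hlog := Real.log_pos hn1'
  rw [EReal.coe_le_coe_iff, div_le_iff₀ (Real.sqrt_pos.2 (by positivity))]
  exact hn
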